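/- Let $k$ be a field and $N\ge 3$. Let $A$ be the affine nilTemperley-Lieb algebra: the unital associative $k$-algebra with generators $a_i$, $i\in\mathbb Z/N$, and relations $a_i^2=0$; $a_ia_j=a_ja_i$ whenever $i-j\ne\pm1$; $a_ia_{i+1}a_i=a_{i+1}a_ia_{i+1}=0$. For a finite sequence $j=(j_1,\dots,j_r)$ in $\mathbb Z/N$ put $a(j)=a_{j_1}\cdots a_{j_r}$ (with $a(\emptyset)=1$). Let $\mathrm{in}(j)$ be the set of those $i\in\mathbb Z/N$ having an occurrence in $j$ with no $i-1$ to its right, $\mathrm{out}(j)$ the set of those $i$ having an occurrence in $j$ with no $i+1$ to its left, and $\ell(j)$ the number of zeros in $j$. For $c\in\mathbb Z/N$ let $\prec_c$ be the order $c\prec_c c+1\prec_c\cdots\prec_c c+N-1$ on $\mathbb Z/N$. Normal form algorithm. From a nonempty $j$ with $a(j)\neq0$, pull out all entries $i$ that have no $i-1$ to their right; they form the block $j^{(0)}$. Repeat with the remaining sequence to get $j^{(1)},\dots,j^{(m)}$, until nothing remains. Let $\hat\imath\in\{0,\dots,N-1\}$ be the largest index such that $\hat\imath$ does not occur in $j^{(0)}$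 but $\hat\imath-1$ (modulo $N$) does, and sort each $j^{(n)}$ increasingly from left to right for $\prec_{\hat\imath+n}$. The resulting sequence of blocks $(j^{(m)})\cdots(j^{(1)})(j^{(0)})$ is the normal form of $j$. A sequence of blocks so obtained (from some such $j$) is said to be in normal form, and so is its monomial $a(j^{(m)})\cdots a(j^{(0)})$. Then: 1. Let $j$ be nonempty with $a(j)\ne0$. The normal form of $j$ is a reordering of $j$ and satisfies $a(j)=a(j^{(m)})\cdots a(j^{(1)})a(j^{(0)})$. It is a block form, that is: there is at least one block and all blocks are nonempty; the underlying set of $j^{(0)}$ is the input set $\mathrm{in}$ of the concatenated sequence $j^{(m)}\cdots j^{(0)}$, and $j^{(0)}$ is strictly increasing for $\prec_{\hat\imath}$, with $\hat\imath$ defined from $j^{(0)}$ as above; each $j^{(n+1)}$ is obtained from $j^{(n)}$ by adding $1$ modulo $N$ to every entry and then omitting some (possibly none) of the entries. The underlying set of $j^{(0)}$ is also $\mathrm{in}(j)$. Moreover, the normal form of $j$ is the only block form whose monomial equals $a(j)$. 2. The monomials in normal form, which are pairwise distinct for distinct normal forms and different from $1$, constitute together with $1$ a $k$-basis of $A$.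 3. The triple $(\mathrm{in}(j),\mathrm{out}(j),\ell(j))$ depends only on the element $a(j)$ as long as $a(j)$ equals a monomial in normal form, and the resulting map $\psi:\{\text{monomials in normal form}\}\to\mathcal P(\mathbb Z/N)\times\mathcal P(\mathbb Z/N)\times\mathbb Z_{\ge0}$ is injective. -/

import Mathlib

namespace AffineNilTL

/-- The defining relations of the affine nilTemperley-Lieb algebra, with indices in `ℤ/N`. -/
inductive Rel (k : Type*) [Field k] (N : ℕ) :
    FreeAlgebra k (ZMod N) → FreeAlgebra k (ZMod N) → Prop
  | sq (i : ZMod N) : Rel k N (FreeAlgebra.ι k i * FreeAlgebra.ι k i) 0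
  | comm (i j : ZMod N) (h₁ : i - j ≠ 1) (h₂ : i - j ≠ -1) :
      Rel k N (FreeAlgebra.ι k i * FreeAlgebra.ι k j) (FreeAlgebra.ι k j * FreeAlgebra.ι k i)
  | braid_up (i : ZMod N) :
      Rel k N (FreeAlgebra.ι k i * FreeAlgebra.ι k (i + 1) * FreeAlgebra.ι k i) 0
  | braid_down (i : ZMod N) :
      Rel k N (FreeAlgebra.ι k (i + 1) * FreeAlgebra.ι k i * FreeAlgebra.ι k (i + 1)) 0

/-- The affine nilTemperley-Lieb algebra of rank `N` over `k`: the unital associative algebra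
with generators indexed by `ℤ/N`, modulo the relations above. -/
abbrev Alg (k : Type*) [Field k] (N : ℕ) : Type _ := RingQuot (Rel k N)

/-- The generator `a_i`. -/
noncomputable def gen (k : Type*) [Field k] {N : ℕ} (i : ZMod N) : Alg k N :=
  RingQuot.mkAlgHom k (Rel k N) (FreeAlgebra.ι k i)

/-- The monomial `a(j) = a_{j_1} ⋯ a_{j_m}` of an index sequence; `a(∅) = 1`. -/
noncomputable def mon (k : Type*) [Field k] {N : ℕ} (j : List (ZMod N)) : Alg k N :=
  (j.map (gen k)).prod

/-- The entries `i` of a sequence with no `i - 1` to their right, in order of appearance. -/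
def pulled {N : ℕ} : List (ZMod N) → List (ZMod N)
  | [] => []
  | i :: w => if i - 1 ∈ w then pulled w else i :: pulled w

/-- The sequence with the entries of `pulled` removed. -/
def remaining {N : ℕ} : List (ZMod N) → List (ZMod N)
  | [] => []
  | i :: w => if i - 1 ∈ w then i :: remaining w else remaining w

theorem length_remaining_le {N : ℕ} (w : List (ZMod N)) :
    (remaining w).length ≤ w.length := by
  induction w with
  | nil => simp [remaining]
  | cons i w ih =>
    unfold remaining
    split
    · simpa using ih
    · simp only [List.length_cons]; omega

theorem length_remaining_lt {N : ℕ} (w : List (ZMod N)) (hw : w ≠ []) :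
    (remaining w).length < w.length := by
  induction w with
  | nil => exact absurd rfl hw
  | cons i w ih =>
    unfold remaining
    split
    · rename_i h
      have := ih (List.ne_nil_of_mem h)
      simpa using this
    · have := length_remaining_le w
      simp only [List.length_cons]; omega

/-- Repeatedly pull out the entries with no predecessor to their right. The list of blocks is
`[j⁽⁰⁾, j⁽¹⁾, …, j⁽ᵐ⁾]`: the block pulled first (which stands rightmost) comes first. -/
def rawBlocks {N : ℕ} (j : List (ZMod N)) : List (List (ZMod N)) :=
  if _h : j = [] then [] else pulled j :: rawBlocks (remaining j)
termination_by j.length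
decreasing_by exact length_remaining_lt j _h

/-- The index sequence `j⁽ᵐ⁾ ⋯ j⁽¹⁾ j⁽⁰⁾` of a list of blocks `[j⁽⁰⁾, …, j⁽ᵐ⁾]`. -/
def wordOf {N : ℕ} (B : List (List (ZMod N))) : List (ZMod N) := B.reverse.flatten

/-- The largest `0 ≤ r ≤ N - 1` such that `r` does not occur in `b` but `r - 1` (modulo `N`)
does, as an element of `ℤ/N`. -/
def gapIndex {N : ℕ} (b : List (ZMod N)) : ZMod N :=
  ((Nat.findGreatest (fun r => (r : ZMod N) ∉ b ∧ (r : ZMod N) - 1 ∈ b) (N - 1) : ℕ) : ZMod N)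

/-- The strict clockwise order `c ≺ c + 1 ≺ ⋯ ≺ c + N - 1` starting at `c`. -/
def cwLT {N : ℕ} (c x y : ZMod N) : Prop := (x - c).val < (y - c).val

/-- The weak clockwise order starting at `c`. -/
def cwLE {N : ℕ} (c x y : ZMod N) : Prop := (x - c).val ≤ (y - c).val

instance {N : ℕ} (c : ZMod N) : DecidableRel (cwLE c) :=
  fun x y => inferInstanceAs (Decidable ((x - c).val ≤ (y - c).val))

/-- The normal form algorithm: form the blocks `j⁽⁰⁾, …, j⁽ᵐ⁾`, let `c` be the gap index of
`j⁽⁰⁾`, and sort the block `j⁽ⁿ⁾` increasingly for the clockwise order starting at `c + n`. -/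
def normalForm {N : ℕ} (j : List (ZMod N)) : List (List (ZMod N)) :=
  (rawBlocks j).mapIdx fun n b =>
    b.insertionSort (cwLE (gapIndex ((rawBlocks j).headD []) + (n : ZMod N)))

/-- A list of blocks is in normal form if the algorithm produces it from a nonempty index
sequence whose monomial is nonzero. -/
def IsNormalForm (k : Type*) [Field k] {N : ℕ} (B : List (List (ZMod N))) : Prop :=
  ∃ j : List (ZMod N), j ≠ [] ∧ mon k j ≠ 0 ∧ normalForm j = B

/-- The set of elements of the algebra that are monomials in normal form. -/
def normalFormMonomials (k : Type*) [Field k] (N : ℕ) : Set (Alg k N) :=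
  {x | ∃ B : List (List (ZMod N)), IsNormalForm k B ∧ mon k (wordOf B) = x}

/-- The input set: the `i` with an occurrence in `j` that has no `i - 1` to its right. -/
def inputSet {N : ℕ} (j : List (ZMod N)) : Set (ZMod N) :=
  {i | ∃ u v : List (ZMod N), j = u ++ i :: v ∧ i - 1 ∉ v}

/-- The output set: the `i` with an occurrence in `j` that has no `i + 1` to its left. -/
def outputSet {N : ℕ} (j : List (ZMod N)) : Set (ZMod N) :=
  {i | ∃ u v : List (ZMod N), j = u ++ i :: v ∧ i + 1 ∉ u}

/-- Input set, output set and number of zeros of an index sequence. -/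
def triple {N : ℕ} (j : List (ZMod N)) : Set (ZMod N) × Set (ZMod N) × ℕ :=
  (inputSet j, outputSet j, j.count 0)

/-- The block normal form, described without the algorithm. The blocks `j⁽⁰⁾, …, j⁽ᵐ⁾` are
nonempty, `j⁽⁰⁾` consists of the input set of the whole sequence, in the clockwise order that
starts at its gap index, and each `j⁽ⁿ⁺¹⁾` arises from `j⁽ⁿ⁾` by adding `1` to all indices and
omitting some of them. -/
structure IsBlockForm {N : ℕ} (B : List (List (ZMod N))) : Prop where
  ne_nil : B ≠ []
  block_ne_nil : ∀ b ∈ B, b ≠ []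
  head_sorted : (B.headD []).Pairwise (cwLT (gapIndex (B.headD [])))
  mem_head : ∀ i, i ∈ B.headD [] ↔ i ∈ inputSet (wordOf B)
  shift : B.IsChain fun b b' => b'.Sublist (b.map (· + 1))

end AffineNilTL

namespace AffineNilTL

/-! ### Projections to neighbouring letters -/

variable {N : ℕ}

/-! The invariant behind all three parts is the family `proj w`, which records for each `e` the
subword of letters `e`, `e + 1`. Distinct commuting letters lie in no common pair, so commutations
leave the family unchanged; conversely, equal families give equal monomials (`mon_eq_of_proj_eq`).
The remaining relations kill every word in which some projection repeats a letter
(`mon_eq_zero_of_not_isAlternating`). They kill nothing else: the algebra acts on the free module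
over all families of lists by prepending a letter when alternation permits and by zero otherwise,
and an alternating word carries the empty family to its own projections (`orbitMap_mon`). So nonzero
monomials correspond to their projection families, and distinct ones are linearly independent.

Normal forms choose one word per family. Moving the pulled block to the right end preserves the
projections of an alternating word (`proj_remaining_append_pulled`). The input set is never all of
`ℤ/N`, so the first block misses its gap index, block `n` misses that index plus `n`, and clockwise
sorting from there never puts `i` left of `i - 1`; the projections survive again. Uniqueness follows
by peeling: the rightmost block is the input set, readable from the projections, and can be
cancelled (`IsBlockFormFrom.eq_of_proj_eq`).

For the triple, inputs and outputs are last and first letters of projections. They fix the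
differences between the counts of `e` and `e + 1`; with the number of zeros this gives all counts,
and an alternating two-letter word is determined by its counts and first letter
(`proj_eq_of_triple_eq`). -/

/-- The projection of an index sequence to the letters `e`, `e + 1`. -/
def proj (w : List (ZMod N)) (e : ZMod N) : List (ZMod N) :=
  w.filter fun x => x = e ∨ x = e + 1

/-- An index sequence all of whose projections to neighbouring letters alternate. -/
def IsAlternating (w : List (ZMod N)) : Prop := ∀ e, (proj w e).IsChain (· ≠ ·)

theorem zmod_one_ne_zero (hN : 3 ≤ N) : (1 : ZMod N) ≠ 0 := by
  intro h
  have h' : ((1 : ℕ) : ZMod N) = 0 := by simpa using h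
  rw [ZMod.natCast_eq_zero_iff] at h'
  exact absurd (Nat.le_of_dvd one_pos h') (by omega)

theorem zmod_two_ne_zero (hN : 3 ≤ N) : (1 + 1 : ZMod N) ≠ 0 := by
  intro h
  have h' : ((2 : ℕ) : ZMod N) = 0 := by rw [← h]; norm_num
  rw [ZMod.natCast_eq_zero_iff] at h'
  exact absurd (Nat.le_of_dvd two_pos h') (by omega)

@[simp] theorem proj_nil (e : ZMod N) : proj [] e = [] := rfl

theorem proj_cons (x : ZMod N) (w : List (ZMod N)) (e : ZMod N) :
    proj (x :: w) e = if x = e ∨ x = e + 1 then x :: proj w e else proj w e := by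
  simp [proj, List.filter_cons]

theorem proj_append (u v : List (ZMod N)) (e : ZMod N) :
    proj (u ++ v) e = proj u e ++ proj v e := by
  simp [proj]

theorem mem_proj {w : List (ZMod N)} {e x : ZMod N} :
    x ∈ proj w e ↔ x ∈ w ∧ (x = e ∨ x = e + 1) := by
  simp [proj]

theorem proj_eq_nil {w : List (ZMod N)} {e : ZMod N} (h₁ : e ∉ w) (h₂ : e + 1 ∉ w) :
    proj w e = [] := by
  rw [List.eq_nil_iff_forall_not_mem]
  intro x hx
  rw [mem_proj] at hx
  rcases hx with ⟨hx, rfl | rfl⟩ <;> contradiction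

theorem count_proj_self (w : List (ZMod N)) (e : ZMod N) :
    (proj w e).count e = w.count e := by
  rw [proj, List.count_filter]; simp

theorem count_proj_succ (w : List (ZMod N)) (e : ZMod N) :
    (proj w e).count (e + 1) = w.count (e + 1) := by
  rw [proj, List.count_filter]; simp

theorem perm_of_proj_eq {w w' : List (ZMod N)} (h : proj w = proj w') : w.Perm w' := by
  rw [List.perm_iff_count]
  intro e
  rw [← count_proj_self w, h, count_proj_self]

theorem eq_nil_of_proj {w : List (ZMod N)} (h : proj w = proj []) : w = [] :=
  (perm_of_proj_eq h).eq_nil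

theorem IsAlternating.of_cons {x : ZMod N} {w : List (ZMod N)} (h : IsAlternating (x :: w)) :
    IsAlternating w := by
  intro e
  have := h e
  rw [proj_cons] at this
  split_ifs at this
  · exact this.tail
  · exact this

theorem isAlternating_cons {x : ZMod N} {w : List (ZMod N)} :
    IsAlternating (x :: w) ↔
      IsAlternating w ∧ (proj w x).head? ≠ some x ∧ (proj w (x - 1)).head? ≠ some x := by
  constructor
  · intro h
    refine ⟨h.of_cons, ?_, ?_⟩
    · have := h x
      rw [proj_cons, if_pos (Or.inl rfl), List.isChain_cons] at this
      intro h'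
      exact this.1 x h' rfl
    · have := h (x - 1)
      rw [proj_cons, if_pos (Or.inr (by ring)), List.isChain_cons] at this
      intro h'
      exact this.1 x h' rfl
  · rintro ⟨h, h₁, h₂⟩ e
    rw [proj_cons]
    split_ifs with hx
    · rw [List.isChain_cons]
      refine ⟨?_, h e⟩
      rintro y hy rfl
      rcases hx with rfl | rfl
      · exact h₁ hy
      · apply h₂
        rw [add_sub_cancel_right]; exact hy
    · exact h e

/-! ### Monomials and the relations -/

variable (k : Type*) [Field k]

@[simp] theorem mon_nil : mon k ([] : List (ZMod N)) = 1 := rfl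

theorem mon_cons (x : ZMod N) (w : List (ZMod N)) : mon k (x :: w) = gen k x * mon k w := by
  simp [mon]

theorem mon_append (u v : List (ZMod N)) : mon k (u ++ v) = mon k u * mon k v := by
  simp [mon]

theorem gen_mul_self (i : ZMod N) : gen k i * gen k i = 0 := by
  rw [gen, ← map_mul, RingQuot.mkAlgHom_rel k (Rel.sq i), map_zero]

theorem gen_comm {i j : ZMod N} (h₁ : i - j ≠ 1) (h₂ : i - j ≠ -1) :
    gen k i * gen k j = gen k j * gen k i := by
  rw [gen, gen, ← map_mul, RingQuot.mkAlgHom_rel k (Rel.comm i j h₁ h₂), map_mul]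

theorem gen_braid {i d : ZMod N} (hd : d = 1 ∨ d = -1) :
    gen k i * gen k (i + d) * gen k i = 0 := by
  rcases hd with rfl | rfl
  · simp only [gen]
    rw [← map_mul, ← map_mul, RingQuot.mkAlgHom_rel k (Rel.braid_up i), map_zero]
  · obtain ⟨j, rfl⟩ : ∃ j, i = j + 1 := ⟨i - 1, by ring⟩
    rw [add_neg_cancel_right]
    simp only [gen]
    rw [← map_mul, ← map_mul, RingQuot.mkAlgHom_rel k (Rel.braid_down j), map_zero]

theorem gen_mul_mon_comm {i : ZMod N} {u : List (ZMod N)} (h₁ : i + 1 ∉ u) (h₂ : i - 1 ∉ u) :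
    gen k i * mon k u = mon k u * gen k i := by
  induction u with
  | nil => simp
  | cons x u ih =>
    simp only [List.mem_cons, not_or] at h₁ h₂
    have hx : gen k i * gen k x = gen k x * gen k i :=
      gen_comm k (fun h => h₂.1 (by rw [← h]; ring)) (fun h => h₁.1 (by linear_combination h))
    rw [mon_cons, ← mul_assoc, hx, mul_assoc, ih h₁.2 h₂.2, mul_assoc]

/-- Between the two copies of `i` the only possible obstruction to commuting is `i + d`. If it is
absent, the square relation applies; if it occurs once, the braid relation applies. If it occurs
twice, the stretch between its first two occurrences is a shorter instance, with `i` in the role of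
the missing letter. -/
theorem gen_mul_mon_mul_gen_eq_zero {d : ZMod N} (hd : d = 1 ∨ d = -1) (n : ℕ) :
    ∀ (u : List (ZMod N)) (i : ZMod N), u.length ≤ n → i ∉ u → i - d ∉ u →
      gen k i * mon k u * gen k i = 0 := by
  have comm : ∀ (i : ZMod N) (u : List (ZMod N)), i - d ∉ u → i + d ∉ u →
      gen k i * mon k u = mon k u * gen k i := by
    intro i u h₁ h₂
    rcases hd with rfl | rfl
    · exact gen_mul_mon_comm k h₂ h₁
    · exact gen_mul_mon_comm k (by simpa using h₁) (by simpa [sub_eq_add_neg] using h₂)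
  induction n with
  | zero =>
    intro u i hu _ _
    rw [List.length_eq_zero_iff.1 (Nat.le_zero.1 hu)]
    simp [gen_mul_self]
  | succ n ih =>
    intro u i hu hi hd'
    by_cases h : i + d ∈ u
    · obtain ⟨x, y, rfl, hx⟩ := List.eq_append_cons_of_mem h
      simp only [List.mem_append, List.mem_cons, not_or] at hi hd'
      by_cases hy : i + d ∈ y
      · obtain ⟨y₁, y₂, rfl, hy₁⟩ := List.eq_append_cons_of_mem hy
        have := ih y₁ (i + d) (by simp at hu; omega) hy₁
          (by rw [add_sub_cancel_right]; exact fun h => hi.2.2 (by simp [h]))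
        simp only [mon_append, mon_cons]
        calc _ = gen k i * mon k x * (gen k (i + d) * mon k y₁ * gen k (i + d)) * mon k y₂ *
              gen k i := by noncomm_ring
          _ = 0 := by rw [this]; simp
      · have e₁ := comm i x hd'.1 hx
        have e₂ := comm i y hd'.2.2 hy
        rw [mon_append, mon_cons]
        calc _ = (gen k i * mon k x) * gen k (i + d) * (mon k y * gen k i) := by noncomm_ring
          _ = mon k x * (gen k i * gen k (i + d) * gen k i) * mon k y := by
            rw [e₁, ← e₂]; noncomm_ring
          _ = 0 := by rw [gen_braid k hd]; simp
    · rw [comm i u hd' h, mul_assoc, gen_mul_self, mul_zero]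

theorem mon_eq_zero_of_not_isAlternating {w : List (ZMod N)} (h : ¬ IsAlternating w) :
    mon k w = 0 := by
  induction w with
  | nil => exact absurd (fun e => by simp) h
  | cons i w ih =>
    rw [mon_cons]
    by_cases hw : IsAlternating w
    swap
    · rw [ih hw, mul_zero]
    -- The two pairs containing `i` are handled together, `i - d` being the other letter of the
    -- pair: a projection starting with `i` means that no `i - d` precedes the first `i` of `w`.
    have key : ∀ e d : ZMod N, (d = 1 ∨ d = -1) → (i = e ∨ i = e + 1) →
        (i - d = e ∨ i - d = e + 1) → (proj w e).head? = some i → gen k i * mon k w = 0 := by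
      intro e d hd he hde hh
      have hi : i ∈ w := (mem_proj.1 (List.mem_of_mem_head? hh)).1
      obtain ⟨x, y, rfl, hx⟩ := List.eq_append_cons_of_mem hi
      have hdx : i - d ∉ x := by
        intro hdx
        have hm : i - d ∈ proj x e := mem_proj.2 ⟨hdx, hde⟩
        rw [proj_append, List.head?_append_of_ne_nil _ (List.ne_nil_of_mem hm)] at hh
        exact hx (mem_proj.1 (List.mem_of_mem_head? hh)).1
      rw [mon_append, mon_cons, ← mul_assoc, ← mul_assoc,
        gen_mul_mon_mul_gen_eq_zero k hd _ x i le_rfl hx hdx, zero_mul]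
    rw [isAlternating_cons] at h
    simp only [hw, true_and, not_and_or, not_not] at h
    rcases h with h | h
    · exact key i (-1) (Or.inr rfl) (Or.inl rfl) (Or.inr (by ring)) h
    · exact key (i - 1) 1 (Or.inl rfl) (Or.inr (by ring)) (Or.inl rfl) h

theorem isAlternating_of_mon_ne_zero {w : List (ZMod N)} (h : mon k w ≠ 0) : IsAlternating w :=
  not_imp_comm.1 (mon_eq_zero_of_not_isAlternating k) h

/-- The first letter `i` of `w` heads both projections that see it. Hence in `w'` neither `i + 1`
nor `i - 1` precedes the first `i`, which can be commuted to the front and cancelled. -/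
theorem mon_eq_of_proj_eq {w w' : List (ZMod N)} (h : proj w = proj w') :
    mon k w = mon k w' := by
  induction w generalizing w' with
  | nil => rw [eq_nil_of_proj h.symm]
  | cons i w ih =>
    have hi : i ∈ w' := (perm_of_proj_eq h).mem_iff.1 (by simp)
    obtain ⟨x, y, rfl, hx⟩ := List.eq_append_cons_of_mem hi
    have key : ∀ e j : ZMod N, (i = e ∨ i = e + 1) → (j = e ∨ j = e + 1) → j ∉ x := by
      intro e j he hj hjx
      have h' := congrArg List.head? (congrFun h e)
      have hm : j ∈ proj x e := mem_proj.2 ⟨hjx, hj⟩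
      rw [proj_cons, if_pos he, proj_append,
        List.head?_append_of_ne_nil _ (List.ne_nil_of_mem hm), List.head?_cons] at h'
      exact hx (mem_proj.1 (List.mem_of_mem_head? h'.symm)).1
    have h₁ := key i (i + 1) (Or.inl rfl) (Or.inr rfl)
    have h₂ := key (i - 1) (i - 1) (Or.inr (by ring)) (Or.inl rfl)
    have hxy : proj w = proj (x ++ y) := by
      funext e
      have h' := congrFun h e
      rw [proj_append, proj_cons, proj_cons] at h'
      rw [proj_append]
      split_ifs at h' with hie
      · have : proj x e = [] := by
          rcases hie with rfl | rfl
          · exact proj_eq_nil hx h₁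
          · rw [add_sub_cancel_right] at h₂
            exact proj_eq_nil h₂ hx
        rw [this] at h' ⊢
        simpa using h'
      · exact h'
    rw [mon_append, mon_cons, mon_cons, ih hxy, mon_append, ← mul_assoc,
      gen_mul_mon_comm k h₁ h₂, mul_assoc]

/-! ### The representation on families of projections -/

/-- The effect of prepending the letter `i` on the family of projections. -/
def push (i : ZMod N) (p : ZMod N → List (ZMod N)) : ZMod N → List (ZMod N) :=
  fun e => if i = e ∨ i = e + 1 then i :: p e else p e

theorem push_proj (i : ZMod N) (w : List (ZMod N)) : push i (proj w) = proj (i :: w) := by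
  funext e
  rw [proj_cons, push]

/-- Prepending the letter `i` keeps the projections involving `i` alternating. -/
def CanPush (i : ZMod N) (p : ZMod N → List (ZMod N)) : Prop :=
  (p i).head? ≠ some i ∧ (p (i - 1)).head? ≠ some i

open Classical in
/-- The action of a generator on the space spanned by families of projections. -/
noncomputable def pushOp (i : ZMod N) : Module.End k ((ZMod N → List (ZMod N)) →₀ k) :=
  Finsupp.linearCombination k fun p =>
    if CanPush i p then Finsupp.single (push i p) (1 : k) else 0

variable {k} in
open Classical in
theorem pushOp_single (i : ZMod N) (p : ZMod N → List (ZMod N)) :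
    pushOp k i (Finsupp.single p 1) =
      if CanPush i p then Finsupp.single (push i p) (1 : k) else 0 := by
  rw [pushOp, Finsupp.linearCombination_single, one_smul]

theorem push_self (i : ZMod N) (p : ZMod N → List (ZMod N)) : push i p i = i :: p i := by
  simp [push]

theorem push_pred (i : ZMod N) (p : ZMod N → List (ZMod N)) :
    push i p (i - 1) = i :: p (i - 1) := by
  simp [push]

theorem push_of_ne {i e : ZMod N} (h₁ : i ≠ e) (h₂ : i ≠ e + 1) (p : ZMod N → List (ZMod N)) :
    push i p e = p e := by
  simp [push, h₁, h₂]

theorem pushOp_mul_self (i : ZMod N) : pushOp k i * pushOp k i = 0 := by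
  refine Finsupp.lhom_ext' fun p => LinearMap.ext_ring ?_
  simp only [LinearMap.comp_apply, Module.End.mul_apply, Finsupp.lsingle_apply, pushOp_single]
  split_ifs with h
  · rw [pushOp_single, if_neg]
    · simp
    · intro h'
      exact h'.1 (by simp [push_self])
  · simp

theorem pushOp_comm {i j : ZMod N} (h₁ : i - j ≠ 1) (h₂ : i - j ≠ -1) :
    pushOp k i * pushOp k j = pushOp k j * pushOp k i := by
  by_cases hij : i = j
  · rw [hij]
  have a₁ : i ≠ j + 1 := fun h => h₁ (by rw [h]; ring)
  have a₂ : j ≠ i + 1 := fun h => h₂ (by rw [h]; ring)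
  have c : ∀ i j : ZMod N, i ≠ j → i ≠ j + 1 → j ≠ i + 1 → ∀ p,
      CanPush i (push j p) ↔ CanPush i p := by
    intro i j h h₁ h₂ p
    rw [CanPush, CanPush, push_of_ne h.symm h₂,
      push_of_ne (fun h' => h₁ (by rw [h']; ring)) (by rwa [sub_add_cancel, ne_comm])]
  refine Finsupp.lhom_ext' fun p => LinearMap.ext_ring ?_
  simp only [LinearMap.comp_apply, Module.End.mul_apply, Finsupp.lsingle_apply, pushOp_single]
  have hp : push i (push j p) = push j (push i p) := by
    funext e
    by_cases hi : i = e ∨ i = e + 1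
    · have hj : ¬ (j = e ∨ j = e + 1) := by
        rintro (rfl | rfl) <;> rcases hi with rfl | rfl <;> simp_all
      simp [push, hi, hj]
    · simp [push, hi]
  by_cases hi : CanPush i p <;> by_cases hj : CanPush j p <;>
    simp [hi, hj, pushOp_single, c i j hij a₁ a₂, c j i (Ne.symm hij) a₂ a₁, hp]

/-- The pair `{i - 1, i}` does not see `i + 1`, so its list still starts with `i` when the second
`i` arrives. For `N = 2` this would fail, since then `i + 1 = i - 1`. -/
theorem pushOp_braid_up (hN : 3 ≤ N) (i : ZMod N) :
    pushOp k i * pushOp k (i + 1) * pushOp k i = 0 := by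
  refine Finsupp.lhom_ext' fun p => LinearMap.ext_ring ?_
  simp only [LinearMap.comp_apply, Module.End.mul_apply, Finsupp.lsingle_apply, pushOp_single]
  have h : ¬ CanPush i (push (i + 1) (push i p)) := by
    intro h
    apply h.2
    rw [push_of_ne, push_pred, List.head?_cons]
    · intro h
      exact zmod_two_ne_zero hN (by linear_combination h)
    · intro h
      exact zmod_one_ne_zero hN (by linear_combination h)
  split_ifs
  · rw [pushOp_single]
    split_ifs
    · rw [pushOp_single, if_neg h]; rfl
    · simp
  · simp

theorem pushOp_braid_down (hN : 3 ≤ N) (i : ZMod N) :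
    pushOp k (i + 1) * pushOp k i * pushOp k (i + 1) = 0 := by
  refine Finsupp.lhom_ext' fun p => LinearMap.ext_ring ?_
  simp only [LinearMap.comp_apply, Module.End.mul_apply, Finsupp.lsingle_apply, pushOp_single]
  have h : ¬ CanPush (i + 1) (push i (push (i + 1) p)) := by
    intro h
    apply h.1
    rw [push_of_ne, push_self, List.head?_cons]
    · intro h
      exact zmod_one_ne_zero hN (by linear_combination -h)
    · intro h
      exact zmod_two_ne_zero hN (by linear_combination -h)
  split_ifs
  · rw [pushOp_single]
    split_ifs
    · rw [pushOp_single, if_neg h]; rfl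
    · simp
  · simp

/-- The action of the algebra on the space spanned by families of projections. -/
noncomputable def pushRep (hN : 3 ≤ N) :
    Alg k N →ₐ[k] Module.End k ((ZMod N → List (ZMod N)) →₀ k) :=
  RingQuot.liftAlgHom k ⟨FreeAlgebra.lift k (pushOp k), by
    intro x y h
    induction h with
    | sq i => simp [pushOp_mul_self]
    | comm i j h₁ h₂ => simp [pushOp_comm k h₁ h₂]
    | braid_up i => simp [pushOp_braid_up k hN]
    | braid_down i => simp [pushOp_braid_down k hN]⟩

theorem pushRep_gen (hN : 3 ≤ N) (i : ZMod N) : pushRep k hN (gen k i) = pushOp k i := by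
  simp [pushRep, gen]

/-- The orbit map of the family of empty projections. -/
noncomputable def orbitMap (hN : 3 ≤ N) : Alg k N →ₗ[k] ((ZMod N → List (ZMod N)) →₀ k) :=
  (LinearMap.applyₗ (Finsupp.single (proj []) 1)).comp (pushRep k hN).toLinearMap

theorem orbitMap_mon (hN : 3 ≤ N) {w : List (ZMod N)} (hw : IsAlternating w) :
    orbitMap k hN (mon k w) = Finsupp.single (proj w) 1 := by
  induction w with
  | nil => simp [orbitMap]
  | cons i w ih =>
    have ih := ih hw.of_cons
    simp only [orbitMap, LinearMap.comp_apply, AlgHom.toLinearMap_apply,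
      LinearMap.applyₗ_apply_apply] at ih ⊢
    rw [mon_cons, map_mul, Module.End.mul_apply, ih, pushRep_gen, pushOp_single,
      if_pos (show CanPush i (proj w) from (isAlternating_cons.1 hw).2), push_proj]

theorem proj_eq_of_mon_eq (hN : 3 ≤ N) {w w' : List (ZMod N)} (hw : mon k w ≠ 0)
    (h : mon k w = mon k w') : proj w = proj w' := by
  have h₁ := orbitMap_mon k hN (isAlternating_of_mon_ne_zero k hw)
  have h₂ := orbitMap_mon k hN (isAlternating_of_mon_ne_zero k (h ▸ hw))
  rw [h, h₂] at h₁
  exact (Finsupp.single_left_injective one_ne_zero h₁).symm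

end AffineNilTL

namespace AffineNilTL

variable {N : ℕ}

/-! ### Input and output sets -/

theorem mem_inputSet_nil {i : ZMod N} : i ∉ inputSet [] := by
  rintro ⟨u, v, h, -⟩
  simp at h

theorem mem_inputSet_cons {i x : ZMod N} {w : List (ZMod N)} :
    i ∈ inputSet (x :: w) ↔ i ∈ inputSet w ∨ (i = x ∧ i - 1 ∉ w) := by
  constructor
  · rintro ⟨u, v, h, hv⟩
    cases u with
    | nil =>
      rw [List.nil_append, List.cons.injEq] at h
      obtain ⟨rfl, rfl⟩ := h
      exact Or.inr ⟨rfl, hv⟩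
    | cons y u =>
      rw [List.cons_append, List.cons.injEq] at h
      exact Or.inl ⟨u, v, h.2, hv⟩
  · rintro (⟨u, v, rfl, hv⟩ | ⟨rfl, hv⟩)
    · exact ⟨x :: u, v, rfl, hv⟩
    · exact ⟨[], w, rfl, hv⟩

theorem mem_inputSet_concat {i x : ZMod N} {w : List (ZMod N)} :
    i ∈ inputSet (w ++ [x]) ↔ i = x ∨ (i ∈ inputSet w ∧ i - 1 ≠ x) := by
  induction w with
  | nil => simp [mem_inputSet_cons, mem_inputSet_nil]
  | cons y w ih =>
    rw [List.cons_append, mem_inputSet_cons, ih, mem_inputSet_cons]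
    simp only [List.mem_append, List.mem_singleton]
    tauto

/-- Together with `mem_outputSet_iff`, this makes inputs and outputs functions of the projections,
hence of a nonzero monomial. -/
theorem mem_inputSet_iff (hN : 3 ≤ N) {i : ZMod N} {w : List (ZMod N)} :
    i ∈ inputSet w ↔ (proj w (i - 1)).getLast? = some i := by
  induction w using List.reverseRecOn with
  | nil => simp [mem_inputSet_nil]
  | append_singleton w x ih =>
    rw [mem_inputSet_concat, ih, proj_append, proj_cons, sub_add_cancel, proj_nil]
    have := zmod_one_ne_zero hN
    by_cases h₁ : i = x
    · simp [h₁]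
    · by_cases h₂ : i - 1 = x
      · simp [h₁, h₂, Ne.symm h₁]
      · simp [h₁, h₂, Ne.symm h₁, Ne.symm h₂]

theorem mem_outputSet_cons {i x : ZMod N} {w : List (ZMod N)} :
    i ∈ outputSet (x :: w) ↔ i = x ∨ (i ∈ outputSet w ∧ i + 1 ≠ x) := by
  constructor
  · rintro ⟨u, v, h, hu⟩
    cases u with
    | nil =>
      rw [List.nil_append, List.cons.injEq] at h
      exact Or.inl h.1.symm
    | cons y u =>
      rw [List.cons_append, List.cons.injEq] at h
      rw [List.mem_cons, not_or] at hu
      exact Or.inr ⟨⟨u, v, h.2, hu.2⟩, h.1 ▸ hu.1⟩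
  · rintro (rfl | ⟨⟨u, v, rfl, hu⟩, hx⟩)
    · exact ⟨[], w, rfl, by simp⟩
    · exact ⟨x :: u, v, rfl, by simp [hu, hx]⟩

theorem mem_outputSet_iff {i : ZMod N} {w : List (ZMod N)} :
    i ∈ outputSet w ↔ (proj w i).head? = some i := by
  induction w with
  | nil =>
    simp only [proj_nil, List.head?_nil, reduceCtorEq, iff_false]
    rintro ⟨u, v, h, -⟩
    simp at h
  | cons x w ih =>
    rw [mem_outputSet_cons, ih, proj_cons]
    by_cases h₁ : x = i
    · simp [h₁]
    · by_cases h₂ : x = i + 1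
      · subst h₂
        simp [h₁, Ne.symm h₁]
      · simp [h₁, h₂, Ne.symm h₁, Ne.symm h₂]

theorem inputSet_congr (hN : 3 ≤ N) {w w' : List (ZMod N)} (h : proj w = proj w') :
    inputSet w = inputSet w' := by
  ext i
  rw [mem_inputSet_iff hN, mem_inputSet_iff hN, h]

theorem triple_congr (hN : 3 ≤ N) {w w' : List (ZMod N)} (h : proj w = proj w') :
    triple w = triple w' := by
  have : outputSet w = outputSet w' := by
    ext i
    rw [mem_outputSet_iff, mem_outputSet_iff, h]
  rw [triple, triple, inputSet_congr hN h, this, (perm_of_proj_eq h).count_eq]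

/-- If `x` is the last letter, every `x + 1` has an `x` to its right. This supplies the gap that a
clockwise order needs as its starting point. -/
theorem exists_notMem_inputSet (hN : 3 ≤ N) (w : List (ZMod N)) : ∃ i, i ∉ inputSet w := by
  induction w using List.reverseRecOn with
  | nil => exact ⟨0, mem_inputSet_nil⟩
  | append_singleton w x ih =>
    refine ⟨x + 1, fun h => ?_⟩
    rw [mem_inputSet_concat] at h
    rcases h with h | h
    · exact zmod_one_ne_zero hN (by linear_combination h)
    · exact h.2 (by ring)

/-! ### The triple determines the projections -/

/-- Letters of an alternating two-letter word pair off, so only its two ends contribute to the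
difference. -/
theorem count_sub_count_of_isChain_ne {α : Type*} [DecidableEq α] {a b : α} (hab : a ≠ b)
    {l : List α} (hl : l.IsChain (· ≠ ·)) (hmem : ∀ x ∈ l, x = a ∨ x = b) :
    (l.count a : ℤ) - l.count b =
      (if l.head? = some a then 1 else 0) - (if l.getLast? = some b then 1 else 0) := by
  induction l with
  | nil => simp
  | cons x t ih =>
    have ih := ih hl.tail fun y hy => hmem y (by simp [hy])
    cases t with
    | nil =>
      rcases hmem x (by simp) with rfl | rfl
      · simp [hab]
      · simp [Ne.symm hab]
    | cons y t =>
      have hxy : x ≠ y := (List.isChain_cons_cons.1 hl).1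
      rw [List.getLast?_cons_cons, List.count_cons (l := y :: t), List.count_cons (l := y :: t)]
      generalize (if (y :: t).getLast? = some b then (1 : ℤ) else 0) = q at ih ⊢
      rcases hmem x (by simp) with hx | hx <;> rcases hmem y (by simp) with hy | hy
      · exact absurd (hx.trans hy.symm) hxy
      · simp only [List.head?_cons, hx, hy, Option.some.injEq, Ne.symm hab] at ih ⊢
        simp [hab] at ih ⊢
        omega
      · simp only [List.head?_cons, hx, hy, Option.some.injEq, Ne.symm hab] at ih ⊢
        simp [Ne.symm hab] at ih ⊢
        omega
      · exact absurd (hx.trans hy.symm) hxy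

theorem eq_of_isChain_ne {α : Type*} [DecidableEq α] {a b : α} (hab : a ≠ b) {l l' : List α}
    (hl : l.IsChain (· ≠ ·)) (hl' : l'.IsChain (· ≠ ·)) (hmem : ∀ x ∈ l, x = a ∨ x = b)
    (hperm : l.Perm l') (hhead : l.head? = some a ↔ l'.head? = some a) : l = l' := by
  induction l generalizing l' with
  | nil => exact hperm.nil_eq
  | cons x t ih =>
    cases l' with
    | nil => simpa using hperm.length_eq
    | cons y t' =>
      have hmem' : ∀ z ∈ y :: t', z = a ∨ z = b := fun z hz => hmem z (hperm.mem_iff.2 hz)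
      have hxy : x = y := by
        have h : x = a ↔ y = a := by simpa using hhead
        rcases hmem x (by simp) with hx | hx
        · rw [hx, h.1 hx]
        · rcases hmem' y (by simp) with hy | hy
          · rw [h.2 hy, hy]
          · rw [hx, hy]
      subst hxy
      have hp := (List.perm_cons x).1 hperm
      have aux : ∀ s : List α, (x :: s).IsChain (· ≠ ·) → (∀ z ∈ x :: s, z = a ∨ z = b) →
          (s.head? = some a ↔ x ≠ a ∧ s.length ≠ 0) := by
        intro s hs hm
        cases s with
        | nil => simp
        | cons z s =>
          have h₁ : x ≠ z := (List.isChain_cons_cons.1 hs).1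
          have h₂ := hm x (by simp)
          have h₃ := hm z (by simp)
          simp only [List.head?_cons, Option.some.injEq, List.length_cons]
          constructor
          · rintro rfl
            exact ⟨h₁, by omega⟩
          · rintro ⟨h, -⟩
            rcases h₃ with h₃ | h₃
            · exact h₃
            · rcases h₂ with h₂ | h₂
              · exact absurd h₂ h
              · exact absurd (h₂.trans h₃.symm) h₁
      rw [ih (l' := t') hl.tail hl'.tail (fun z hz => hmem z (by simp [hz])) hp
        (by rw [aux t hl hmem, aux t' hl' hmem', hp.length_eq])]

theorem count_eq_of_triple_eq (hN : 3 ≤ N) {w w' : List (ZMod N)} (hw : IsAlternating w)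
    (hw' : IsAlternating w') (h : triple w = triple w') (i : ZMod N) :
    w.count i = w'.count i := by
  have : NeZero N := ⟨by omega⟩
  simp only [triple, Prod.mk.injEq] at h
  obtain ⟨hin, hout, h0⟩ := h
  -- The third entry of the triple anchors the count at `0`; the ends of the projections carry it
  -- from `r` to `r + 1` around the circle.
  suffices ∀ r : ℕ, w.count (r : ZMod N) = w'.count (r : ZMod N) by
    simpa using this i.val
  intro r
  induction r with
  | zero => simpa using h0
  | succ r ih =>
    have step : ∀ v : List (ZMod N), IsAlternating v →
        (v.count (r : ZMod N) : ℤ) - v.count ((r : ZMod N) + 1) =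
        (if (proj v r).head? = some (r : ZMod N) then 1 else 0) -
          (if (proj v r).getLast? = some ((r : ZMod N) + 1) then 1 else 0) := by
      intro v hv
      rw [← count_sub_count_of_isChain_ne _ (hv r) fun x hx => (mem_proj.1 hx).2,
        count_proj_self, count_proj_succ]
      intro h
      exact zmod_one_ne_zero hN (by linear_combination -h)
    have e₁ : (proj w r).head? = some (r : ZMod N) ↔ (proj w' r).head? = some (r : ZMod N) := by
      rw [← mem_outputSet_iff, ← mem_outputSet_iff, hout]
    have e₂ : (proj w r).getLast? = some ((r : ZMod N) + 1) ↔
        (proj w' r).getLast? = some ((r : ZMod N) + 1) := by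
      have := @mem_inputSet_iff N hN (r + 1)
      rw [add_sub_cancel_right] at this
      rw [← this, ← this, hin]
    have s₁ := step w hw
    have s₂ := step w' hw'
    rw [← if_congr e₁ rfl rfl, ← if_congr e₂ rfl rfl] at s₂
    push_cast
    omega

theorem proj_eq_of_triple_eq (hN : 3 ≤ N) {w w' : List (ZMod N)} (hw : IsAlternating w)
    (hw' : IsAlternating w') (h : triple w = triple w') : proj w = proj w' := by
  have hp : w.Perm w' := List.perm_iff_count.2 (count_eq_of_triple_eq hN hw hw' h)
  funext e
  refine eq_of_isChain_ne (a := e) (b := e + 1) ?_ (hw e) (hw' e)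
    (fun x hx => (mem_proj.1 hx).2) (hp.filter _) ?_
  · intro h
    exact zmod_one_ne_zero hN (by linear_combination -h)
  · simp only [triple, Prod.mk.injEq] at h
    rw [← mem_outputSet_iff, ← mem_outputSet_iff, h.2.1]

/-! ### Clockwise orders -/

theorem val_add_one {z : ZMod N} (hN : 3 ≤ N) (h : z + 1 ≠ 0) : (z + 1).val = z.val + 1 := by
  have : NeZero N := ⟨by omega⟩
  have : Fact (1 < N) := ⟨by omega⟩
  have hz := ZMod.val_lt z
  rw [ZMod.val_add_of_lt, ZMod.val_one]
  rw [ZMod.val_one]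
  refine lt_of_le_of_ne hz fun h' => h ?_
  have : ((z.val + 1 : ℕ) : ZMod N) = 0 := by rw [show z.val + 1 = N from h']; simp
  simpa using this

theorem cwLT_irrefl (c x : ZMod N) : ¬ cwLT c x x := lt_irrefl _

theorem cwLT_self_add_one (hN : 3 ≤ N) {c x : ZMod N} (h : x + 1 ≠ c) : cwLT c x (x + 1) := by
  have : x - c + 1 ≠ 0 := fun h' => h (by linear_combination h')
  rw [cwLT, show x + 1 - c = x - c + 1 by ring, val_add_one hN this]
  omega

theorem cwLT_add_one {c x y : ZMod N} : cwLT (c + 1) (x + 1) (y + 1) ↔ cwLT c x y := by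
  rw [cwLT, cwLT, add_sub_add_right_eq_sub, add_sub_add_right_eq_sub]

theorem cwLE_antisymm [NeZero N] {c x y : ZMod N} (h₁ : cwLE c x y) (h₂ : cwLE c y x) :
    x = y := by
  have := ZMod.val_injective N (le_antisymm h₁ h₂)
  linear_combination this

theorem nodup_of_pairwise_cwLT {c : ZMod N} {l : List (ZMod N)} (h : l.Pairwise (cwLT c)) :
    l.Nodup :=
  h.imp fun {x y} hxy => by
    rintro rfl
    exact cwLT_irrefl _ _ hxy

theorem eq_of_pairwise_cwLT [NeZero N] {c : ZMod N} {l l' : List (ZMod N)}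
    (h : l.Pairwise (cwLT c)) (h' : l'.Pairwise (cwLT c)) (hm : ∀ i, i ∈ l ↔ i ∈ l') :
    l = l' :=
  List.Perm.eq_of_pairwise (fun _ _ _ _ h₁ h₂ => absurd h₁ (lt_asymm h₂)) h h'
    ((List.perm_ext_iff_of_nodup (nodup_of_pairwise_cwLT h) (nodup_of_pairwise_cwLT h')).2 hm)

theorem pairwise_cwLT_insertionSort [NeZero N] (c : ZMod N) {l : List (ZMod N)} (h : l.Nodup) :
    (l.insertionSort (cwLE c)).Pairwise (cwLT c) := by
  have : Std.Total (cwLE c) := ⟨fun _ _ => le_total _ _⟩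
  have : IsTrans (ZMod N) (cwLE c) := ⟨fun _ _ _ => le_trans⟩
  have h₁ := List.pairwise_insertionSort (cwLE c) l
  have h₂ : (l.insertionSort (cwLE c)).Nodup := (List.perm_insertionSort _ l).nodup_iff.2 h
  exact (h₁.and h₂).imp fun {x y} hxy =>
    lt_of_le_of_ne hxy.1 fun h' => hxy.2 (cwLE_antisymm hxy.1 h'.ge)

/-- A sequence without repetitions in which `i` never stands to the
left of `i - 1`. -/
def IsAscending (l : List (ZMod N)) : Prop := l.Pairwise fun x y => x ≠ y ∧ x ≠ y + 1

/-- The clockwise order places `x` before `x + 1` except at the wrap-around, where `x + 1 = c`; this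
exception is void when `c` is missing. -/
theorem isAscending_of_pairwise_cwLT (hN : 3 ≤ N) {c : ZMod N} {l : List (ZMod N)}
    (h : l.Pairwise (cwLT c)) (hc : c ∉ l) : IsAscending l := by
  refine h.imp_of_mem fun {x y} hx _ hxy => ⟨?_, ?_⟩
  · rintro rfl
    exact cwLT_irrefl _ _ hxy
  · rintro rfl
    exact lt_asymm hxy (cwLT_self_add_one hN (ne_of_mem_of_not_mem hx hc))

theorem IsAscending.nodup {l : List (ZMod N)} (h : IsAscending l) : l.Nodup := h.imp And.left

/-- Each projection has at most one `e` and one `e + 1`, and their order is forced. Hence resorting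
a block is harmless. -/
theorem IsAscending.proj_eq {l l' : List (ZMod N)} (h : IsAscending l) (h' : IsAscending l')
    (hp : l.Perm l') : proj l = proj l' := by
  funext e
  refine List.Perm.eq_of_pairwise ?_ (h.filter _) (h'.filter _) (hp.filter _)
  rintro x y hx hy ⟨h₁, h₂⟩ ⟨-, h₄⟩
  rcases (mem_proj.1 hx).2 with rfl | rfl <;> rcases (mem_proj.1 hy).2 with rfl | rfl <;> simp_all

/-! ### Pulling out a block -/

theorem mem_pulled {i : ZMod N} {w : List (ZMod N)} : i ∈ pulled w ↔ i ∈ inputSet w := by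
  induction w with
  | nil => simp [pulled, mem_inputSet_nil]
  | cons x w ih =>
    rw [mem_inputSet_cons, pulled]
    split_ifs with h
    · rw [ih]
      constructor
      · exact Or.inl
      · rintro (h' | ⟨rfl, h'⟩)
        · exact h'
        · exact absurd h h'
    · rw [List.mem_cons, ih, or_comm]
      refine or_congr Iff.rfl ⟨?_, And.left⟩
      rintro rfl
      exact ⟨rfl, h⟩

theorem mem_of_mem_inputSet {i : ZMod N} {w : List (ZMod N)} (h : i ∈ inputSet w) : i ∈ w := by
  obtain ⟨u, v, rfl, -⟩ := h
  simp

theorem mem_of_mem_remaining {i : ZMod N} {w : List (ZMod N)} (h : i ∈ remaining w) :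
    i ∈ w ∧ i - 1 ∈ w := by
  induction w with
  | nil => simp [remaining] at h
  | cons x w ih =>
    rw [remaining] at h
    split_ifs at h with hx
    · rw [List.mem_cons] at h
      rcases h with rfl | h
      · simp [hx]
      · simp [ih h]
    · simp [ih h]

theorem IsAlternating.notMem_of_sub_one_notMem {x : ZMod N} {w : List (ZMod N)}
    (h : IsAlternating (x :: w)) (hx : x - 1 ∉ w) : x ∉ w := by
  intro hxw
  have hm : x ∈ proj w (x - 1) := mem_proj.2 ⟨hxw, Or.inr (by ring)⟩
  obtain ⟨y, hy⟩ : ∃ y, (proj w (x - 1)).head? = some y :=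
    ⟨_, List.head?_eq_some_head (List.ne_nil_of_mem hm)⟩
  have hy' := mem_proj.1 (List.mem_of_mem_head? hy)
  rcases hy'.2 with rfl | rfl
  · exact hx hy'.1
  · rw [sub_add_cancel] at hy
    exact (isAlternating_cons.1 h).2.2 hy

theorem isAscending_pulled {w : List (ZMod N)} (h : IsAlternating w) :
    IsAscending (pulled w) := by
  induction w with
  | nil => exact List.Pairwise.nil
  | cons x w ih =>
    rw [pulled]
    split_ifs with hx
    · exact ih h.of_cons
    · refine List.pairwise_cons.2 ⟨fun y hy => ?_, ih h.of_cons⟩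
      have hyw : y ∈ w := mem_of_mem_inputSet (mem_pulled.1 hy)
      constructor
      · rintro rfl
        exact h.notMem_of_sub_one_notMem hx hyw
      · rintro rfl
        rw [add_sub_cancel_right] at hx
        exact hx hyw

/-- A pulled letter `x` has neither `x - 1` nor, by alternation, `x` to its right. A later `x + 1`
can remain only if an `x` stands to its right, so `x` commutes past everything that remains. -/
theorem proj_remaining_append_pulled {w : List (ZMod N)} (h : IsAlternating w) (e : ZMod N) :
    proj w e = proj (remaining w) e ++ proj (pulled w) e := by
  induction w with
  | nil => rfl
  | cons x w ih =>
    have ih := ih h.of_cons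
    rw [remaining, pulled]
    by_cases hx : x - 1 ∈ w
    · rw [if_pos hx, if_pos hx, proj_cons, proj_cons, ih]
      split_ifs <;> simp
    · rw [if_neg hx, if_neg hx, proj_cons, proj_cons, ih]
      split_ifs with he
      · have hxw := h.notMem_of_sub_one_notMem hx
        have : proj (remaining w) e = [] := by
          rcases he with rfl | rfl
          · refine proj_eq_nil (fun h' => hxw (mem_of_mem_remaining h').1) fun h' => hxw ?_
            simpa using (mem_of_mem_remaining h').2
          · rw [add_sub_cancel_right] at hx
            exact proj_eq_nil (fun h' => hx (mem_of_mem_remaining h').1)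
              fun h' => hxw (mem_of_mem_remaining h').1
        simp [this]
      · rfl

theorem IsAlternating.remaining {w : List (ZMod N)} (h : IsAlternating w) :
    IsAlternating (remaining w) := by
  intro e
  have := h e
  rw [proj_remaining_append_pulled h] at this
  exact this.left_of_append

/-- An `i` that survives the first round has an `i - 1` to its right; if it is pulled in the second,
no such `i - 1` has survived, so one was pulled in the first. -/
theorem sub_one_mem_pulled_of_mem_pulled_remaining {i : ZMod N} {w : List (ZMod N)}
    (hi : i ∈ pulled (remaining w)) : i - 1 ∈ pulled w := by
  induction w with
  | nil => simp [remaining, pulled] at hi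
  | cons x w ih =>
    rw [remaining] at hi
    rw [pulled]
    by_cases hx : x - 1 ∈ w
    · rw [if_pos hx] at hi ⊢
      rw [mem_pulled, mem_inputSet_cons, ← mem_pulled] at hi
      rcases hi with hi | ⟨rfl, hi⟩
      · exact ih hi
      -- Here `i - 1` occurs in `w` but not in `remaining w`; a separate induction on `w` locates it
      -- in `pulled w`.
      · clear ih
        induction w with
        | nil => simp at hx
        | cons y w ih =>
          rw [AffineNilTL.remaining] at hi
          rw [pulled]
          split_ifs at hi ⊢ with hy
          · simp only [List.mem_cons, not_or] at hi hx
            exact ih hi.2 (hx.resolve_left hi.1)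
          · rw [List.mem_cons] at hx ⊢
            by_cases h : i - 1 ∈ w
            · exact Or.inr (ih hi h)
            · exact Or.inl (hx.resolve_right h)
    · rw [if_neg hx] at hi ⊢
      exact List.mem_cons_of_mem _ (ih hi)

end AffineNilTL

namespace AffineNilTL

variable {N : ℕ}

/-! ### Block forms with a prescribed starting point -/

/-- Block forms whose first block is ordered clockwise from `c ∉ b`, the next one from `c + 1`,
and so on. -/
def IsBlockFormFrom : ZMod N → List (List (ZMod N)) → Prop
  | _, [] => True
  | c, b :: B => b ≠ [] ∧ b.Pairwise (cwLT c) ∧ c ∉ b ∧ (∀ i ∈ B.headD [], i - 1 ∈ b) ∧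
      IsBlockFormFrom (c + 1) B

@[simp] theorem wordOf_nil : wordOf ([] : List (List (ZMod N))) = [] := rfl

theorem wordOf_cons (b : List (ZMod N)) (B : List (List (ZMod N))) :
    wordOf (b :: B) = wordOf B ++ b := by
  simp [wordOf]

theorem inputSet_append_subset {i : ZMod N} {u v : List (ZMod N)} (h : i ∈ inputSet (u ++ v)) :
    i ∈ inputSet v ∨ (i ∈ inputSet u ∧ i - 1 ∉ v) := by
  induction u with
  | nil => exact Or.inl h
  | cons x u ih =>
    rw [List.cons_append, mem_inputSet_cons] at h
    rw [mem_inputSet_cons]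
    rcases h with h | ⟨rfl, h⟩
    · rcases ih h with h | h
      · exact Or.inl h
      · exact Or.inr ⟨Or.inl h.1, h.2⟩
    · rw [List.mem_append, not_or] at h
      exact Or.inr ⟨Or.inr ⟨rfl, h.1⟩, h.2⟩

theorem mem_inputSet_append_right {i : ZMod N} {u v : List (ZMod N)} (h : i ∈ inputSet v) :
    i ∈ inputSet (u ++ v) := by
  obtain ⟨x, y, rfl, hy⟩ := h
  exact ⟨u ++ x, y, by simp, hy⟩

theorem IsAscending.mem_inputSet {l : List (ZMod N)} (h : IsAscending l) {i : ZMod N}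
    (hi : i ∈ l) : i ∈ inputSet l := by
  obtain ⟨x, y, rfl, -⟩ := List.eq_append_cons_of_mem hi
  refine ⟨x, y, rfl, fun hy => ?_⟩
  have := (List.pairwise_cons.1 (List.pairwise_append.1 h).2.1).1 _ hy
  exact this.2 (by ring)

/-- Inside an ascending block every entry is an input. An input contributed by the later blocks
would, by induction, lie in the second block, so its predecessor lies in `b`, to its right. -/
theorem IsBlockFormFrom.mem_head_iff (hN : 3 ≤ N) {c : ZMod N} {B : List (List (ZMod N))}
    (h : IsBlockFormFrom c B) (i : ZMod N) :
    i ∈ B.headD [] ↔ i ∈ inputSet (wordOf B) := by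
  induction B generalizing c i with
  | nil => simp [mem_inputSet_nil]
  | cons b B ih =>
    obtain ⟨-, hs, hc, hsub, hB⟩ := h
    rw [wordOf_cons, List.headD_cons]
    constructor
    · exact fun hi =>
        mem_inputSet_append_right ((isAscending_of_pairwise_cwLT hN hs hc).mem_inputSet hi)
    · intro hi
      rcases inputSet_append_subset hi with hi | ⟨hi, hi'⟩
      · exact mem_of_mem_inputSet hi
      · exact absurd (hsub i ((ih hB i).2 hi)) hi'

theorem IsBlockFormFrom.wordOf_ne_nil {c : ZMod N} {b : List (ZMod N)}
    {B : List (List (ZMod N))} (h : IsBlockFormFrom c (b :: B)) : wordOf (b :: B) ≠ [] := by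
  rw [wordOf_cons]
  exact fun h' => h.1 (List.append_eq_nil_iff.1 h').2

theorem IsBlockFormFrom.eq_of_proj_eq (hN : 3 ≤ N) {c : ZMod N} {B B' : List (List (ZMod N))}
    (h : IsBlockFormFrom c B) (h' : IsBlockFormFrom c B')
    (hp : proj (wordOf B) = proj (wordOf B')) : B = B' := by
  have : NeZero N := ⟨by omega⟩
  induction B generalizing c B' with
  | nil =>
    cases B' with
    | nil => rfl
    | cons b' B' => exact absurd (eq_nil_of_proj hp.symm) h'.wordOf_ne_nil
  | cons b B ih =>
    cases B' with
    | nil => exact absurd (eq_nil_of_proj hp) h.wordOf_ne_nil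
    | cons b' B' =>
      have hb : b = b' := by
        refine eq_of_pairwise_cwLT h.2.1 h'.2.1 fun i => ?_
        have h₁ := h.mem_head_iff hN i
        have h₂ := h'.mem_head_iff hN i
        rw [inputSet_congr hN hp, ← h₂] at h₁
        exact h₁
      subst hb
      have hp' : proj (wordOf B) = proj (wordOf B') := by
        funext e
        have := congrFun hp e
        rw [wordOf_cons, wordOf_cons, proj_append, proj_append] at this
        exact List.append_cancel_right this
      rw [ih h.2.2.2.2 h'.2.2.2.2 hp']

/-! ### The gap index -/

theorem gapIndex_congr {b b' : List (ZMod N)} (h : ∀ i, i ∈ b ↔ i ∈ b') :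
    gapIndex b = gapIndex b' := by
  simp only [gapIndex, h]

/-- Were there no index missing from `b` whose predecessor is present, stepping down from the
missing `c` would show that `b` is empty. -/
theorem gapIndex_notMem (hN : 3 ≤ N) {b : List (ZMod N)} (hb : b ≠ []) {c : ZMod N}
    (hc : c ∉ b) : gapIndex b ∉ b := by
  have : NeZero N := ⟨by omega⟩
  have hex : ∃ r : ZMod N, r ∉ b ∧ r - 1 ∈ b := by
    by_contra! hno
    refine hb (List.eq_nil_iff_forall_not_mem.2 ?_)
    have hall : ∀ n : ℕ, c - n ∉ b := by
      intro n
      induction n with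
      | zero => simpa using hc
      | succ n ih =>
        have := hno _ ih
        rwa [Nat.cast_succ, ← sub_sub]
    intro i
    simpa using hall (c - i).val
  obtain ⟨r, hr⟩ := hex
  -- An actual witness at most `N - 1` is needed, because `Nat.findGreatest` returns `0` when there
  -- is none.
  have h := Nat.findGreatest_spec
    (P := fun r : ℕ => (r : ZMod N) ∉ b ∧ (r : ZMod N) - 1 ∈ b) (m := r.val) (n := N - 1)
    (Nat.le_sub_one_of_lt (ZMod.val_lt r)) (by simpa using hr)
  exact h.1

/-! ### Block forms start at their gap index -/

theorem isBlockFormFrom_of_isChain {c : ZMod N} {b : List (ZMod N)} {B : List (List (ZMod N))}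
    (hne : ∀ x ∈ b :: B, x ≠ []) (hs : b.Pairwise (cwLT c)) (hc : c ∉ b)
    (hB : (b :: B).IsChain fun b b' => b'.Sublist (b.map (· + 1))) :
    IsBlockFormFrom c (b :: B) := by
  induction B generalizing b c with
  | nil => exact ⟨hne b (by simp), hs, hc, by simp, trivial⟩
  | cons b' B ih =>
    obtain ⟨hbb', hB⟩ := List.isChain_cons_cons.1 hB
    have hsub : ∀ i ∈ b', i - 1 ∈ b := by
      intro i hi
      obtain ⟨x, hx, rfl⟩ := List.mem_map.1 (hbb'.subset hi)
      simpa using hx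
    refine ⟨hne b (by simp), hs, hc, hsub, ih (fun x hx => hne x (by simp [hx])) ?_ ?_ hB⟩
    · refine List.Pairwise.sublist hbb' (List.pairwise_map.2 (hs.imp fun {x y} h => ?_))
      exact cwLT_add_one.2 h
    · intro h
      have := hsub _ h
      rw [add_sub_cancel_right] at this
      exact hc this

theorem IsBlockForm.isBlockFormFrom (hN : 3 ≤ N) {B : List (List (ZMod N))}
    (h : IsBlockForm B) : IsBlockFormFrom (gapIndex (B.headD [])) B := by
  obtain ⟨c, hc⟩ := exists_notMem_inputSet hN (wordOf B)
  rw [← h.mem_head] at hc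
  cases B with
  | nil => exact absurd rfl h.ne_nil
  | cons b B =>
    exact isBlockFormFrom_of_isChain h.block_ne_nil h.head_sorted
      (gapIndex_notMem hN (h.block_ne_nil b (by simp)) hc) h.shift

/-- Both lists are sorted for the order starting at `c + 1`, so containment of entries already gives
a sublist. -/
theorem IsBlockFormFrom.sublist_map [NeZero N] {c : ZMod N} {b b' : List (ZMod N)}
    (hb : b.Pairwise (cwLT c)) (hb' : b'.Pairwise (cwLT (c + 1))) (h : ∀ i ∈ b', i - 1 ∈ b) :
    b'.Sublist (b.map (· + 1)) := by
  have : Std.Antisymm (cwLE (c + 1)) := ⟨fun _ _ => cwLE_antisymm⟩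
  have hmap : (b.map (· + 1)).Pairwise (cwLE (c + 1)) :=
    List.pairwise_map.2 (hb.imp fun {x y} h => (cwLT_add_one.2 h).le)
  refine List.sublist_of_subperm_of_pairwise (r := cwLE (c + 1)) ?_ (hb'.imp fun {x y} h => h.le)
    hmap
  refine List.subperm_of_subset (nodup_of_pairwise_cwLT hb') fun i hi => ?_
  exact List.mem_map.2 ⟨i - 1, h i hi, by ring⟩

theorem IsBlockFormFrom.block_ne_nil {c : ZMod N} {B : List (List (ZMod N))}
    (h : IsBlockFormFrom c B) : ∀ b ∈ B, b ≠ [] := by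
  induction B generalizing c with
  | nil => simp
  | cons b B ih =>
    intro x hx
    rcases List.mem_cons.1 hx with rfl | hx
    · exact h.1
    · exact ih h.2.2.2.2 x hx

theorem IsBlockFormFrom.shift [NeZero N] {c : ZMod N} {B : List (List (ZMod N))}
    (h : IsBlockFormFrom c B) : B.IsChain fun b b' => b'.Sublist (b.map (· + 1)) := by
  induction B generalizing c with
  | nil => exact List.IsChain.nil
  | cons b B ih =>
    obtain ⟨-, hb, -, hsub, hB⟩ := h
    refine List.isChain_cons.2 ⟨fun b' hb' => ?_, ih hB⟩
    cases B with
    | nil => simp at hb'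
    | cons b'' B =>
      obtain rfl : b'' = b' := by simpa using hb'
      exact sublist_map hb hB.2.1 hsub

theorem IsBlockFormFrom.isBlockForm (hN : 3 ≤ N) {B : List (List (ZMod N))}
    (h : IsBlockFormFrom (gapIndex (B.headD [])) B) (hB : B ≠ []) : IsBlockForm B := by
  have : NeZero N := ⟨by omega⟩
  refine ⟨hB, h.block_ne_nil, ?_, h.mem_head_iff hN, h.shift⟩
  cases B with
  | nil => exact absurd rfl hB
  | cons b B => exact h.2.1

/-! ### The algorithm -/

/-- The blocks of `j`, ordered clockwise from `c`, `c + 1`, …. -/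
def sortedBlocks (c : ZMod N) (j : List (ZMod N)) : List (List (ZMod N)) :=
  (rawBlocks j).mapIdx fun n b => b.insertionSort (cwLE (c + (n : ZMod N)))

theorem rawBlocks_nil : rawBlocks ([] : List (ZMod N)) = [] := by
  rw [rawBlocks]; simp

theorem rawBlocks_of_ne_nil {j : List (ZMod N)} (hj : j ≠ []) :
    rawBlocks j = pulled j :: rawBlocks (remaining j) := by
  rw [rawBlocks]; simp [hj]

theorem sortedBlocks_nil (c : ZMod N) : sortedBlocks c [] = [] := by
  rw [sortedBlocks, rawBlocks_nil]; rfl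

theorem sortedBlocks_of_ne_nil (c : ZMod N) {j : List (ZMod N)} (hj : j ≠ []) :
    sortedBlocks c j =
      (pulled j).insertionSort (cwLE c) :: sortedBlocks (c + 1) (remaining j) := by
  rw [sortedBlocks, rawBlocks_of_ne_nil hj, List.mapIdx_cons, sortedBlocks]
  simp only [Nat.cast_zero, add_zero, Nat.cast_add, Nat.cast_one, add_assoc, add_comm (1 : ZMod N)]

theorem mem_headD_sortedBlocks {c i : ZMod N} {j : List (ZMod N)} :
    i ∈ (sortedBlocks c j).headD [] ↔ i ∈ pulled j := by
  by_cases hj : j = []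
  · subst hj
    simp [sortedBlocks_nil, pulled]
  · simp [sortedBlocks_of_ne_nil c hj]

theorem pulled_ne_nil {j : List (ZMod N)} (hj : j ≠ []) : pulled j ≠ [] := by
  induction j with
  | nil => exact absurd rfl hj
  | cons x w ih =>
    rw [pulled]
    split_ifs with hx
    · exact ih (List.ne_nil_of_mem hx)
    · simp

/-- The starting point must vary in the induction: the next block starts at `c + 1`, which it misses
because each of its entries has its predecessor in the current block. -/
theorem isBlockFormFrom_sortedBlocks (hN : 3 ≤ N) (n : ℕ) :
    ∀ (j : List (ZMod N)) (c : ZMod N), j.length ≤ n → IsAlternating j → c ∉ pulled j →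
      IsBlockFormFrom c (sortedBlocks c j) ∧ proj (wordOf (sortedBlocks c j)) = proj j := by
  have : NeZero N := ⟨by omega⟩
  induction n with
  | zero =>
    intro j c hj _ _
    obtain rfl := List.length_eq_zero_iff.1 (Nat.le_zero.1 hj)
    rw [sortedBlocks_nil]
    exact ⟨trivial, rfl⟩
  | succ n ih =>
    intro j c hj hA hc
    by_cases hj0 : j = []
    · subst hj0
      rw [sortedBlocks_nil]
      exact ⟨trivial, rfl⟩
    have hlen := length_remaining_lt j hj0
    have hsub : ∀ i ∈ pulled (remaining j), i - 1 ∈ pulled j := fun i =>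
      sub_one_mem_pulled_of_mem_pulled_remaining
    obtain ⟨h₁, h₂⟩ := ih (remaining j) (c + 1) (by omega) hA.remaining fun h => hc (by
      simpa using hsub _ h)
    have hs := pairwise_cwLT_insertionSort c (isAscending_pulled hA).nodup
    have hcs : c ∉ (pulled j).insertionSort (cwLE c) := by simpa using hc
    rw [sortedBlocks_of_ne_nil c hj0]
    refine ⟨⟨?_, hs, hcs, ?_, h₁⟩, ?_⟩
    · intro h
      obtain ⟨i, hi⟩ := List.exists_mem_of_ne_nil _ (pulled_ne_nil hj0)
      rw [← List.mem_insertionSort (cwLE c), h] at hi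
      simp at hi
    · intro i hi
      rw [List.mem_insertionSort]
      exact hsub i (mem_headD_sortedBlocks.1 hi)
    · funext e
      rw [wordOf_cons, proj_append, h₂, proj_remaining_append_pulled hA e,
        (isAscending_of_pairwise_cwLT hN hs hcs).proj_eq (isAscending_pulled hA)
          (List.perm_insertionSort _ _)]

theorem normalForm_eq {j : List (ZMod N)} (hj : j ≠ []) :
    normalForm j = sortedBlocks (gapIndex (pulled j)) j := by
  rw [normalForm, sortedBlocks, rawBlocks_of_ne_nil hj]
  rfl

theorem mem_headD_normalForm {j : List (ZMod N)} (hj : j ≠ []) (i : ZMod N) :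
    i ∈ (normalForm j).headD [] ↔ i ∈ inputSet j := by
  rw [normalForm_eq hj, mem_headD_sortedBlocks, mem_pulled]

theorem isBlockFormFrom_normalForm (hN : 3 ≤ N) {j : List (ZMod N)} (hj : j ≠ [])
    (hA : IsAlternating j) :
    IsBlockFormFrom (gapIndex ((normalForm j).headD [])) (normalForm j) ∧
      proj (wordOf (normalForm j)) = proj j := by
  obtain ⟨c, hc⟩ := exists_notMem_inputSet hN j
  rw [← mem_pulled] at hc
  have hg : gapIndex ((normalForm j).headD []) = gapIndex (pulled j) :=
    gapIndex_congr fun i => by rw [mem_headD_normalForm hj, mem_pulled]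
  rw [hg, normalForm_eq hj]
  exact isBlockFormFrom_sortedBlocks hN _ j _ le_rfl hA
    (gapIndex_notMem hN (pulled_ne_nil hj) hc)

theorem isBlockForm_normalForm (hN : 3 ≤ N) {j : List (ZMod N)} (hj : j ≠ [])
    (hA : IsAlternating j) : IsBlockForm (normalForm j) := by
  refine (isBlockFormFrom_normalForm hN hj hA).1.isBlockForm hN ?_
  rw [normalForm_eq hj, sortedBlocks_of_ne_nil _ hj]
  simp

/-- Equal projections give first blocks with the same entries, hence the same gap index, so both
forms are compared from a common starting point. -/
theorem IsBlockForm.eq_of_proj_eq (hN : 3 ≤ N) {B B' : List (List (ZMod N))}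
    (h : IsBlockForm B) (h' : IsBlockForm B') (hp : proj (wordOf B) = proj (wordOf B')) :
    B = B' := by
  have hg : gapIndex (B.headD []) = gapIndex (B'.headD []) :=
    gapIndex_congr fun i => by rw [h.mem_head, h'.mem_head, inputSet_congr hN hp]
  exact (h.isBlockFormFrom hN).eq_of_proj_eq hN (hg ▸ h'.isBlockFormFrom hN) hp

/-! ### The basis -/

variable (k : Type*) [Field k]

theorem IsNormalForm.isBlockForm (hN : 3 ≤ N) {B : List (List (ZMod N))}
    (h : IsNormalForm k B) : IsBlockForm B := by
  obtain ⟨j, hj, hne, rfl⟩ := h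
  exact isBlockForm_normalForm hN hj (isAlternating_of_mon_ne_zero k hne)

theorem IsNormalForm.mon_ne_zero (hN : 3 ≤ N) {B : List (List (ZMod N))}
    (h : IsNormalForm k B) : mon k (wordOf B) ≠ 0 := by
  obtain ⟨j, hj, hne, rfl⟩ := h
  rwa [mon_eq_of_proj_eq k
    (isBlockFormFrom_normalForm hN hj (isAlternating_of_mon_ne_zero k hne)).2]

/-- The index sequence of a normal form, or the empty sequence. -/
def normalFormWord : Option {B : List (List (ZMod N)) // IsNormalForm k B} → List (ZMod N)
  | none => []
  | some B => wordOf B.1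

theorem isAlternating_normalFormWord (hN : 3 ≤ N)
    (o : Option {B : List (List (ZMod N)) // IsNormalForm k B}) :
    IsAlternating (normalFormWord k o) := by
  cases o with
  | none => exact fun e => List.IsChain.nil
  | some B => exact isAlternating_of_mon_ne_zero k (B.2.mon_ne_zero k hN)

theorem proj_normalFormWord_injective (hN : 3 ≤ N) :
    Function.Injective fun o : Option {B : List (List (ZMod N)) // IsNormalForm k B} =>
      proj (normalFormWord k o) := by
  have hne : ∀ B : {B : List (List (ZMod N)) // IsNormalForm k B}, wordOf B.1 ≠ [] := by
    rintro ⟨B, hB⟩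
    have h := hB.isBlockForm k hN
    cases B with
    | nil => exact absurd rfl h.ne_nil
    | cons b B => exact (h.isBlockFormFrom hN).wordOf_ne_nil
  rintro (_ | B) (_ | B') h
  · rfl
  · exact absurd (eq_nil_of_proj h.symm) (hne B')
  · exact absurd (eq_nil_of_proj h) (hne B)
  · rw [Subtype.ext ((B.2.isBlockForm k hN).eq_of_proj_eq hN (B'.2.isBlockForm k hN) h)]

/-- The orbit map sends these monomials to distinct standard basis vectors. -/
theorem linearIndependent_normalForm (hN : 3 ≤ N) :
    LinearIndependent k fun o : Option {B : List (List (ZMod N)) // IsNormalForm k B} =>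
      mon k (normalFormWord k o) := by
  refine LinearIndependent.of_comp (orbitMap k hN) ?_
  have : (orbitMap k hN ∘ fun o : Option {B : List (List (ZMod N)) // IsNormalForm k B} =>
      mon k (normalFormWord k o)) =
      (fun p => Finsupp.single p (1 : k)) ∘ fun o => proj (normalFormWord k o) :=
    funext fun o => orbitMap_mon k hN (isAlternating_normalFormWord k hN o)
  rw [this]
  exact (Finsupp.linearIndependent_single_one k _).comp _ (proj_normalFormWord_injective k hN)

theorem span_range_mon : Submodule.span k (Set.range (mon k : List (ZMod N) → Alg k N)) = ⊤ := by
  rw [eq_top_iff]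
  rintro x -
  obtain ⟨y, rfl⟩ := RingQuot.mkAlgHom_surjective k (Rel k N) x
  induction y with
  | grade0 r =>
    rw [AlgHom.commutes, Algebra.algebraMap_eq_smul_one]
    exact Submodule.smul_mem _ _ (Submodule.subset_span ⟨[], rfl⟩)
  | grade1 i => exact Submodule.subset_span ⟨[i], by simp [mon, gen]⟩
  | add x y hx hy => rw [map_add]; exact add_mem hx hy
  | mul x y hx hy =>
    rw [map_mul]
    have := Submodule.mul_mem_mul hx hy
    rw [Submodule.span_mul_span] at this
    refine Submodule.span_mono ?_ this
    rintro _ ⟨_, ⟨u, rfl⟩, _, ⟨v, rfl⟩, rfl⟩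
    exact ⟨u ++ v, mon_append k u v⟩

theorem span_range_normalForm (hN : 3 ≤ N) :
    Submodule.span k (Set.range
      fun o : Option {B : List (List (ZMod N)) // IsNormalForm k B} =>
        mon k (normalFormWord k o)) = ⊤ := by
  rw [eq_top_iff, ← span_range_mon k, Submodule.span_le]
  rintro _ ⟨j, rfl⟩
  by_cases hj : j = []
  · subst hj
    exact Submodule.subset_span ⟨none, rfl⟩
  by_cases h : mon k j = 0
  · rw [h]
    exact zero_mem _
  · refine Submodule.subset_span ⟨some ⟨normalForm j, j, hj, h, rfl⟩, ?_⟩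
    exact mon_eq_of_proj_eq k
      (isBlockFormFrom_normalForm hN hj (isAlternating_of_mon_ne_zero k h)).2

/-- The basis of the algebra formed by `1` and the monomials in normal form. -/
noncomputable def normalFormBasis (hN : 3 ≤ N) :
    Module.Basis (Option {B : List (List (ZMod N)) // IsNormalForm k B}) k (Alg k N) :=
  Module.Basis.mk (linearIndependent_normalForm k hN) (span_range_normalForm k hN).ge

theorem ne_zero_of_mem_normalFormMonomials (hN : 3 ≤ N) {x : Alg k N}
    (hx : x ∈ normalFormMonomials k N) : x ≠ 0 := by
  obtain ⟨B, hB, rfl⟩ := hx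
  exact hB.mon_ne_zero k hN

end AffineNilTL

/-- Parts: (1) the algorithm rewrites every nonzero nonconstant monomial, by reordering its
factors, into a block normal form whose rightmost block is the input set of the given sequence,
and this block normal form is unique; (2) the monomials in normal form (pairwise distinct)
together with `1` form a basis; (3) the triple of input set, output set and number of zeros does
not depend on the chosen index sequence and is injective on monomials in normal form. -/
theorem theorem8p3 (k : Type*) [Field k] (N : ℕ) (hN : 3 ≤ N) :
    (∀ j : List (ZMod N), j ≠ [] → AffineNilTL.mon k j ≠ 0 →
      AffineNilTL.mon k (AffineNilTL.wordOf (AffineNilTL.normalForm j)) = AffineNilTL.mon k j ∧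
      (AffineNilTL.wordOf (AffineNilTL.normalForm j)).Perm j ∧
      AffineNilTL.IsBlockForm (AffineNilTL.normalForm j) ∧
      (∀ i, i ∈ (AffineNilTL.normalForm j).headD [] ↔ i ∈ AffineNilTL.inputSet j) ∧
      ∀ B : List (List (ZMod N)), AffineNilTL.IsBlockForm B →
        AffineNilTL.mon k (AffineNilTL.wordOf B) = AffineNilTL.mon k j →
        B = AffineNilTL.normalForm j) ∧
    (∃ b : Module.Basis (Option {B : List (List (ZMod N)) // AffineNilTL.IsNormalForm k B}) k
        (AffineNilTL.Alg k N),
      b none = 1 ∧ ∀ B, b (some B) = AffineNilTL.mon k (AffineNilTL.wordOf B.1)) ∧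
    (∃ ψ : AffineNilTL.normalFormMonomials k N → Set (ZMod N) × Set (ZMod N) × ℕ,
      (∀ (j : List (ZMod N)) (hj : AffineNilTL.mon k j ∈ AffineNilTL.normalFormMonomials k N),
        ψ ⟨AffineNilTL.mon k j, hj⟩ = AffineNilTL.triple j) ∧
      Function.Injective ψ) := by
  refine ⟨fun j hj hne => ?_, ⟨AffineNilTL.normalFormBasis k hN, ?_, ?_⟩, ?_⟩
  · have hA := AffineNilTL.isAlternating_of_mon_ne_zero k hne
    have hp := (AffineNilTL.isBlockFormFrom_normalForm hN hj hA).2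
    have hB := AffineNilTL.isBlockForm_normalForm hN hj hA
    refine ⟨AffineNilTL.mon_eq_of_proj_eq k hp, AffineNilTL.perm_of_proj_eq hp, hB,
      AffineNilTL.mem_headD_normalForm hj, fun B hB' hmon => hB'.eq_of_proj_eq hN hB ?_⟩
    rw [hp, AffineNilTL.proj_eq_of_mon_eq k hN hne hmon.symm]
  · simp [AffineNilTL.normalFormBasis, AffineNilTL.normalFormWord]
  · intro B
    simp [AffineNilTL.normalFormBasis, AffineNilTL.normalFormWord]
  · have hex : ∀ x : AffineNilTL.normalFormMonomials k N, ∃ j, AffineNilTL.mon k j = x.1 := by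
      rintro ⟨_, B, -, rfl⟩
      exact ⟨_, rfl⟩
    choose f hf using hex
    have hf0 : ∀ x, AffineNilTL.mon k (f x) ≠ 0 := fun x => by
      rw [hf]
      exact AffineNilTL.ne_zero_of_mem_normalFormMonomials k hN x.2
    -- The chosen word `f x` is arbitrary: words with the same nonzero monomial have the same
    -- projections, hence the same triple.
    refine ⟨fun x => AffineNilTL.triple (f x), fun j hj => ?_, fun x y hxy => ?_⟩
    · exact AffineNilTL.triple_congr hN (AffineNilTL.proj_eq_of_mon_eq k hN (hf0 _) (hf ⟨_, hj⟩))
    · have hp := AffineNilTL.proj_eq_of_triple_eq hN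
        (AffineNilTL.isAlternating_of_mon_ne_zero k (hf0 x))
        (AffineNilTL.isAlternating_of_mon_ne_zero k (hf0 y)) hxy
      rw [Subtype.ext_iff, ← hf x, ← hf y, AffineNilTL.mon_eq_of_proj_eq k hp]
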